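/- Let $\Omega,A\subset\mathbb{R}$ be compact intervals, let $p$ be a Borel probability measure on $\Omega$ (the common prior), and let $U,V:\Omega\times A\to\mathbb{R}$ be the utilities of a receiver and of a sender, where $U(\omega,a)$, $V(\omega,a)$ depend on the state $\omega$ and the receiver's action $a$. Assume that for every $\omega\in\Omega$ the function $U(\omega,\cdot)$ is twice differentiable and strictly concave on $A$ with $U_{aa}(\omega,\cdot)<0$, and $U_a(\omega,a)=0$ for some $a\in A$; that $V(\omega,\cdot)$ is differentiable on $A$ for every $\omega\in\Omega$; that $U_a(\cdot,a)$ and $V_a(\cdot,a)$ are continuous on $\Omega$ for every $a\in A$; that $V_a$ is bounded on $\Omega\times A$; and that $U(\cdot,a)$ and $V(\cdot,a)$ are $p$-integrable for every $a\in A$. (Derivatives at the end points of $A$ are one-sided.) An information structure is a measurable space $M$ of messages together with a Markov kernel from states to messages, to which the sender commits before learning the state. After a message $m$ the receiver takes the action in $A$ that maximizes his expected utility $\mathbb{E}(U(\omega,a)\mid m)$ under the posterior belief given $m$, and the sender's payoff is the resulting expectation of $V$. Full disclosure is the information structure in which the message is the state. An information structure is suboptimal if some other information structure gives the sender a strictly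 larger payoff. Suppose that there are two states $\omega_1,\omega_2$ in the support of $p$ such that $$\frac{V_a(\omega_1,a_1)}{-U_{aa}(\omega_1,a_1)}>\frac{V_a(\omega_2,a_2)}{-U_{aa}(\omega_2,a_2)}$$ for all $a_1,a_2\in A$ with $a_1<a_2$ and $U_a(\omega_1,a_1)<0<U_a(\omega_2,a_2)$, and that at least one such pair $(a_1,a_2)$ exists. Then full disclosure is suboptimal for the sender. -/

import Mathlib

open MeasureTheory ProbabilityTheory Set

noncomputable section

/-- The data of a sender-receiver environment. States and actions are real numbers in the compact
intervals `[stateLo, stateHi]` and `[actLo, actHi]`; `U` and `V` are the utilities of the receiver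
and of the sender (first argument: the state, second argument: the action), and `prior` is the
common prior over states. -/
structure Environment where
  stateLo : ℝ
  stateHi : ℝ
  actLo : ℝ
  actHi : ℝ
  U : ℝ → ℝ → ℝ
  V : ℝ → ℝ → ℝ
  prior : Measure ℝ
  isProb : IsProbabilityMeasure prior
  prior_states : prior (Icc stateLo stateHi)ᶜ = 0

attribute [instance] Environment.isProb

namespace Environment

/-- The set of states. -/
def Ω (E : Environment) : Set ℝ := Icc E.stateLo E.stateHi

/-- The set of actions. -/
def A (E : Environment) : Set ℝ := Icc E.actLo E.actHi

/-- The partial derivative `U_a` (one-sided at the end points of `A`). -/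
def Ua (E : Environment) (ω a : ℝ) : ℝ := derivWithin (E.U ω) E.A a

/-- The second partial derivative `U_aa` (one-sided at the end points of `A`). -/
def Uaa (E : Environment) (ω a : ℝ) : ℝ := derivWithin (E.Ua ω) E.A a

/-- The partial derivative `V_a` (one-sided at the end points of `A`). -/
def Va (E : Environment) (ω a : ℝ) : ℝ := derivWithin (E.V ω) E.A a

/-- The standing assumptions on the two utility functions. -/
structure Regular (E : Environment) : Prop where
  /-- `U` is twice differentiable in the action, -/
  U_diff : ∀ ω ∈ E.Ω, DifferentiableOn ℝ (E.U ω) E.A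
  Ua_diff : ∀ ω ∈ E.Ω, DifferentiableOn ℝ (E.Ua ω) E.A
  /-- strictly concave in the action, with negative second derivative, -/
  U_concave : ∀ ω ∈ E.Ω, StrictConcaveOn ℝ E.A (E.U ω)
  Uaa_neg : ∀ ω ∈ E.Ω, ∀ a ∈ E.A, E.Uaa ω a < 0
  /-- with a zero of `U_a` in every state, -/
  Ua_zero : ∀ ω ∈ E.Ω, ∃ a ∈ E.A, E.Ua ω a = 0
  /-- and `U_a` is continuous in the state. -/
  Ua_cont : ∀ a ∈ E.A, ContinuousOn (fun ω => E.Ua ω a) E.Ω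
  /-- `V` is differentiable in the action, -/
  V_diff : ∀ ω ∈ E.Ω, DifferentiableOn ℝ (E.V ω) E.A
  /-- and `V_a` is continuous in the state and bounded. -/
  Va_cont : ∀ a ∈ E.A, ContinuousOn (fun ω => E.Va ω a) E.Ω
  Va_bdd : ∃ K : ℝ, ∀ ω ∈ E.Ω, ∀ a ∈ E.A, |E.Va ω a| ≤ K
  /-- Each action has a well-defined finite ex ante expected utility for both parties. -/
  U_int : ∀ a ∈ E.A, Integrable (fun ω => E.U ω a) E.prior
  V_int : ∀ a ∈ E.A, Integrable (fun ω => E.V ω a) E.prior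

end Environment

/-- An information structure: a message space together with a measurable assignment of a
distribution over messages to every state. -/
structure InfoStructure where
  Msg : Type
  [measMsg : MeasurableSpace Msg]
  kernel : Kernel ℝ Msg
  [markov : IsMarkovKernel kernel]

attribute [instance] InfoStructure.measMsg InfoStructure.markov

/-- Full disclosure: the message is the state. -/
def fullDisclosure : InfoStructure where
  Msg := ℝ
  kernel := Kernel.id

namespace Environment

/-- `α` is an optimal strategy of the receiver under the information structure `I`: after almost
every message `m` (for the distribution of messages induced by the prior) the action `α m`
maximizes his expected utility under the posterior belief given `m`. -/
def IsBestResponse (E : Environment) (I : InfoStructure) (α : I.Msg → ℝ) : Prop :=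
  Measurable α ∧ (∀ m, α m ∈ E.A) ∧
    ∀ᵐ m ∂(E.prior.bind I.kernel),
      IsMaxOn (fun a => ∫ ω, E.U ω a ∂(posterior I.kernel E.prior m)) E.A (α m)

/-- `v` is the expected utility of the sender under the information structure `I`, when the
receiver reacts optimally. The pair (state, message) is distributed as
`E.prior.compProd I.kernel`. -/
def IsSenderPayoff (E : Environment) (I : InfoStructure) (v : ℝ) : Prop :=
  ∃ α : I.Msg → ℝ, E.IsBestResponse I α ∧
    Integrable (fun q : ℝ × I.Msg => E.V q.1 (α q.2)) (E.prior.compProd I.kernel) ∧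
    v = ∫ q, E.V q.1 (α q.2) ∂(E.prior.compProd I.kernel)

/-- `I` is suboptimal for the sender: some other information structure gives her a strictly
larger expected utility. -/
def IsSuboptimal (E : Environment) (I : InfoStructure) : Prop :=
  ∃ v : ℝ, E.IsSenderPayoff I v ∧
    ∃ (I' : InfoStructure) (v' : ℝ), E.IsSenderPayoff I' v' ∧ v < v'

/-- The pairs of actions to which the non-transparency condition for `ω₁, ω₂` applies. -/
def Opposed (E : Environment) (ω₁ ω₂ a₁ a₂ : ℝ) : Prop :=
  a₁ ∈ E.A ∧ a₂ ∈ E.A ∧ a₁ < a₂ ∧ E.Ua ω₁ a₁ < 0 ∧ 0 < E.Ua ω₂ a₂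

/-- The non-transparency condition for the pair of states `ω₁, ω₂`. -/
def NonTransparent (E : Environment) (ω₁ ω₂ : ℝ) : Prop :=
  ∀ a₁ a₂ : ℝ, E.Opposed ω₁ ω₂ a₁ a₂ →
    E.Va ω₁ a₁ / (-E.Uaa ω₁ a₁) > E.Va ω₂ a₂ / (-E.Uaa ω₂ a₂)

end Environment

end

/-!
Fix an action `x` strictly between the optimal actions of a receiver who knows `ω₁` and of one who
knows `ω₂`, and let `D ω` be the sender's gain when the full-information action `b ω` is replaced
by `x`. Cauchy's mean value theorem for `V` and `U_a` on the interval between `b ωᵢ` and `x` gives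
`D ωᵢ = -U_a(ωᵢ, x) rᵢ`, where `rᵢ` is the ratio `V_a / -U_aa` at an intermediate action.
Non-transparency says `r₂ < r₁`, so for `r` strictly in between `D + r U_a(·, x)` is positive at
both states and, by continuity, near them. Let the states near `ω₁` and `ω₂` join a common pool with
probabilities `w` such that `∫ w U_a(·, x) = 0`, and reveal the state otherwise. The receiver
answers the pooling message with `x`, and the sender gains `∫ w D = ∫ w (D + r U_a(·, x)) > 0`.
-/

open Filter unitInterval
open scoped Topology ENNReal NNReal

section DerivWithin

variable {E : Type*} [NormedAddCommGroup E] [NormedSpace ℝ E] {f : ℝ → E} {t : Set ℝ} {a b x : ℝ}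

theorem hasDerivAt_derivWithin_of_mem_Ioo (ht : t.OrdConnected) (hf : DifferentiableOn ℝ f t)
    (ha : a ∈ t) (hb : b ∈ t) (hx : x ∈ Ioo a b) : HasDerivAt f (derivWithin f t x) x :=
  have hab : Icc a b ⊆ t := ht.out ha hb
  (hf x (hab (Ioo_subset_Icc_self hx))).hasDerivWithinAt.hasDerivAt
    (mem_of_superset (Icc_mem_nhds hx.1 hx.2) hab)

theorem aestronglyMeasurable_derivWithin_uIoc [CompleteSpace E] (ht : t.OrdConnected)
    (hf : DifferentiableOn ℝ f t) (ha : a ∈ t) (hb : b ∈ t) :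
    AEStronglyMeasurable (derivWithin f t) (volume.restrict (uIoc a b)) := by
  rw [uIoc, ← restrict_Ioo_eq_restrict_Ioc]
  refine (stronglyMeasurable_deriv f).aestronglyMeasurable.congr ?_
  filter_upwards [ae_restrict_mem measurableSet_Ioo] with x hx
  exact (hasDerivAt_derivWithin_of_mem_Ioo ht hf (min_rec' (· ∈ t) ha hb)
    (max_rec' (· ∈ t) ha hb) hx).deriv

end DerivWithin

section RealDerivWithin

variable {f g : ℝ → ℝ} {t : Set ℝ} {a b : ℝ}

theorem le_add_derivWithin_mul_sub_of_concaveOn (hf : ConcaveOn ℝ t f) (ha : a ∈ t)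
    (hb : b ∈ t) (hd : DifferentiableWithinAt ℝ f t a) :
    f b ≤ f a + derivWithin f t a * (b - a) := by
  rcases lt_trichotomy a b with hab | rfl | hba
  · have := hf.slope_le_derivWithin ha hb hab hd
    rw [slope_def_field, div_le_iff₀ (sub_pos.2 hab)] at this
    linarith
  · simp
  · have := hf.derivWithin_le_slope hb ha hba hd
    rw [slope_def_field, le_div_iff₀ (sub_pos.2 hba)] at this
    linarith

theorem exists_sub_eq_derivWithin_div_mul_sub (ht : t.OrdConnected)
    (hf : DifferentiableOn ℝ f t) (hg : DifferentiableOn ℝ g t) (ha : a ∈ t) (hb : b ∈ t)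
    (hab : a < b) (hg' : ∀ x ∈ Ioo a b, derivWithin g t x ≠ 0) :
    ∃ c ∈ Ioo a b, f b - f a = derivWithin f t c / derivWithin g t c * (g b - g a) := by
  have hI : Icc a b ⊆ t := ht.out ha hb
  obtain ⟨c, hc, h⟩ := exists_ratio_hasDerivAt_eq_ratio_slope f (derivWithin f t) hab
    (hf.continuousOn.mono hI) (fun x => hasDerivAt_derivWithin_of_mem_Ioo ht hf ha hb)
    g (derivWithin g t) (hg.continuousOn.mono hI)
    (fun x => hasDerivAt_derivWithin_of_mem_Ioo ht hg ha hb)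
  refine ⟨c, hc, ?_⟩
  rw [div_mul_eq_mul_div, eq_div_iff (hg' c hc), ← h, mul_comm]

end RealDerivWithin

section ParametricIncrement

variable {X E : Type*} [TopologicalSpace X] [NormedAddCommGroup E] [NormedSpace ℝ E]
  {f : X → ℝ → E} {s : Set X} {t : Set ℝ} {a b K : ℝ}

variable (ht : t.OrdConnected) (hf : ∀ x ∈ s, DifferentiableOn ℝ (f x) t)
  (hbound : ∀ x ∈ s, ∀ y ∈ t, ‖derivWithin (f x) t y‖ ≤ K)
  (hcont : ∀ y ∈ t, ContinuousOn (fun x => derivWithin (f x) t y) s)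

include ht hf hbound hcont

theorem continuousOn_sub_of_continuousOn_derivWithin [FirstCountableTopology X] [CompleteSpace E]
    (ha : a ∈ t) (hb : b ∈ t) : ContinuousOn (fun x => f x b - f x a) s := by
  have hI : uIcc a b ⊆ t := ht.uIcc_subset ha hb
  have hmeas : ∀ x ∈ s,
      AEStronglyMeasurable (derivWithin (f x) t) (volume.restrict (uIoc a b)) :=
    fun x hx => aestronglyMeasurable_derivWithin_uIoc ht (hf x hx) ha hb
  have hbound' : ∀ x ∈ s, ∀ y ∈ uIoc a b, ‖derivWithin (f x) t y‖ ≤ K :=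
    fun x hx y hy => hbound x hx y (hI (uIoc_subset_uIcc hy))
  have hFTC : ∀ x ∈ s, ∫ y in a..b, derivWithin (f x) t y = f x b - f x a := by
    intro x hx
    refine intervalIntegral.integral_eq_sub_of_hasDeriv_right ((hf x hx).continuousOn.mono hI)
      (fun y hy => (hasDerivAt_derivWithin_of_mem_Ioo ht (hf x hx) (min_rec' (· ∈ t) ha hb)
        (max_rec' (· ∈ t) ha hb) hy).hasDerivWithinAt) ?_
    exact (intervalIntegrable_const (c := K)).mono_fun' (hmeas x hx)
      ((ae_restrict_iff' measurableSet_uIoc).2 (.of_forall (hbound' x hx)))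
  refine ContinuousOn.congr (fun x hx => ?_) fun x hx => (hFTC x hx).symm
  exact intervalIntegral.continuousWithinAt_of_dominated_interval (bound := fun _ => K)
    (eventually_mem_nhdsWithin.mono hmeas)
    (eventually_mem_nhdsWithin.mono fun z hz => .of_forall (hbound' z hz))
    intervalIntegrable_const
    (.of_forall fun y hy => hcont y (hI (uIoc_subset_uIcc hy)) x hx)

theorem continuousOn_prod_sub_of_continuousOn_derivWithin [FirstCountableTopology X]
    [CompleteSpace E] (ha : a ∈ t) :
    ContinuousOn (fun q : X × ℝ => f q.1 q.2 - f q.1 a) (s ×ˢ t) := by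
  refine continuousOn_prod_of_continuousOn_lipschitzOnWith' _ K.toNNReal (fun x hx => ?_)
    fun b hb => continuousOn_sub_of_continuousOn_derivWithin ht hf hbound hcont ha hb
  refine LipschitzOnWith.of_dist_le_mul fun y hy z hz => ?_
  rw [dist_sub_right]
  exact (ht.convex.lipschitzOnWith_of_nnnorm_derivWithin_le (hf x hx) fun y hy =>
    norm_toNNReal.symm.trans_le (Real.toNNReal_le_toNNReal (hbound x hx y hy))).dist_le_mul
      y hy z hz

end ParametricIncrement

theorem continuousOn_of_strictAntiOn_of_eq_const {X α β : Type*} [TopologicalSpace X]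
    [LinearOrder α] [TopologicalSpace α] [OrderTopology α] [LinearOrder β] [TopologicalSpace β]
    [OrderTopology β] {s : Set X} {t : Set α} {F : X → α → β} {b : X → α} {y : β}
    (ht : t.OrdConnected) (hcont : ∀ a ∈ t, ContinuousOn (fun x => F x a) s)
    (hanti : ∀ x ∈ s, StrictAntiOn (F x) t) (hb : MapsTo b s t) (hFb : ∀ x ∈ s, F x (b x) = y) :
    ContinuousOn b s := by
  intro x hx
  refine tendsto_order.2 ⟨fun a ha => ?_, fun a ha => ?_⟩
  · by_cases hat : a ∈ t
    · have hya : y < F x a := hFb x hx ▸ hanti x hx hat (hb hx) ha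
      filter_upwards [(hcont a hat x hx).eventually_const_lt hya, self_mem_nhdsWithin] with z hz hzs
      exact ((hanti z hzs).lt_iff_gt (hb hzs) hat).1 ((hFb z hzs).trans_lt hz)
    · filter_upwards [self_mem_nhdsWithin] with z hzs
      exact lt_of_not_ge fun h => hat (ht.out (hb hzs) (hb hx) ⟨h, ha.le⟩)
  · by_cases hat : a ∈ t
    · have hay : F x a < y := hFb x hx ▸ hanti x hx (hb hx) hat ha
      filter_upwards [(hcont a hat x hx).eventually_lt_const hay, self_mem_nhdsWithin] with z hz hzs
      exact ((hanti z hzs).lt_iff_gt hat (hb hzs)).1 (hz.trans_eq (hFb z hzs).symm)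
    · filter_upwards [self_mem_nhdsWithin] with z hzs
      exact lt_of_not_ge fun h => hat (ht.out (hb hx) (hb hzs) ⟨ha.le, h⟩)

theorem integrable_of_continuousOn_of_ae_mem {X E : Type*} [TopologicalSpace X]
    [MeasurableSpace X] [OpensMeasurableSpace X] [NormedAddCommGroup E] {μ : Measure X}
    [IsFiniteMeasureOnCompacts μ] {K : Set X} {f : X → E} (hK : IsCompact K)
    (hKm : MeasurableSet K) (hμ : ∀ᵐ x ∂μ, x ∈ K) (hf : ContinuousOn f K) : Integrable f μ := by
  rw [← Measure.restrict_eq_self_of_ae_mem hμ]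
  exact hf.integrableOn_compact' hK hKm

theorem exists_measurableSet_pos_forall_of_mem_support {X : Type*} [TopologicalSpace X]
    [MeasurableSpace X] [OpensMeasurableSpace X] {μ : Measure X} {s : Set X} {x : X} {q : X → Prop}
    (hs : MeasurableSet s) (hμ : ∀ᵐ y ∂μ, y ∈ s) (hx : x ∈ μ.support)
    (hq : ∀ᶠ y in 𝓝[s] x, q y) : ∃ N, MeasurableSet N ∧ 0 < μ N ∧ ∀ y ∈ N, q y := by
  obtain ⟨O, hO, hxO, hOq⟩ := mem_nhdsWithin.1 hq
  refine ⟨O ∩ s, hO.measurableSet.inter hs, ?_, hOq⟩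
  rw [measure_inter_conull (t := s) hμ]
  exact (Measure.mem_support_iff_forall x).1 hx O (hO.mem_nhds hxO)

section Weights

variable {X : Type*} [MeasurableSpace X] {μ : Measure X} {w : X → I} {u f : X → ℝ}

theorem integrable_weight_mul (hw : Measurable w) (hf : Integrable f μ) :
    Integrable (fun x => (w x : ℝ) * f x) μ :=
  hf.bdd_mul (c := 1) hw.subtype_val.aestronglyMeasurable
    (.of_forall fun x => (abs_of_nonneg (w x).2.1).trans_le (w x).2.2)

theorem integral_weight_mul_pos (hw : Measurable w) (hf : Integrable f μ)
    (hpos : ∀ x ∈ Function.support w, 0 < f x) (hμ : 0 < μ (Function.support w)) :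
    0 < ∫ x, (w x : ℝ) * f x ∂μ := by
  have hmul : ∀ x ∈ Function.support w, 0 < (w x : ℝ) * f x := fun x hx =>
    mul_pos (unitInterval.pos_iff_ne_zero.2 hx) (hpos x hx)
  have hnonneg : ∀ x, 0 ≤ (w x : ℝ) * f x := fun x => by
    by_cases hx : w x = 0
    · simp [hx]
    · exact (hmul x hx).le
  rw [integral_pos_iff_support_of_nonneg hnonneg (integrable_weight_mul hw hf)]
  exact hμ.trans_le (measure_mono fun x hx => (hmul x hx).ne')

theorem setIntegral_pos_of_forall_pos {N : Set X} (hN : MeasurableSet N) (hμN : 0 < μ N)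
    (hf : IntegrableOn f N μ) (hpos : ∀ x ∈ N, 0 < f x) : 0 < ∫ x in N, f x ∂μ := by
  rw [setIntegral_pos_iff_support_of_nonneg_ae _ hf,
    inter_eq_self_of_subset_right (s := Function.support f) fun x hx => (hpos x hx).ne']
  · exact hμN
  · filter_upwards [ae_restrict_mem hN] with x hx using (hpos x hx).le

theorem exists_weight_integral_mul_eq_zero {N₁ N₂ : Set X} (hu : Integrable u μ)
    (hN₁ : MeasurableSet N₁) (hN₂ : MeasurableSet N₂) (hμ₁ : 0 < μ N₁) (hμ₂ : 0 < μ N₂)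
    (hneg : ∀ x ∈ N₁, u x < 0) (hpos : ∀ x ∈ N₂, 0 < u x) :
    ∃ w : X → I, Measurable w ∧ Function.support w = N₁ ∪ N₂ ∧
      ∫ x, (w x : ℝ) * u x ∂μ = 0 := by
  classical
  have hI₁ : ∫ x in N₁, u x ∂μ < 0 := by
    simpa [integral_neg] using setIntegral_pos_of_forall_pos hN₁ hμ₁ hu.neg.integrableOn
      fun x hx => neg_pos.2 (hneg x hx)
  have hI₂ := setIntegral_pos_of_forall_pos hN₂ hμ₂ hu.integrableOn hpos
  obtain ⟨c₁, c₂, hc₁, hc₂, hc, hbalance⟩ : (0 : ℝ) ∈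
      openSegment ℝ (∫ x in N₁, u x ∂μ) (∫ x in N₂, u x ∂μ) := by
    rw [openSegment_eq_Ioo (hI₁.trans hI₂)]
    exact ⟨hI₁, hI₂⟩
  lift c₁ to I using ⟨hc₁.le, by linarith⟩
  lift c₂ to I using ⟨hc₂.le, by linarith⟩
  have hdisj : Disjoint N₁ N₂ := disjoint_left.2 fun x h₁ h₂ => (hneg x h₁).not_gt (hpos x h₂)
  refine ⟨N₁.piecewise (fun _ => c₁) (N₂.piecewise (fun _ => c₂) 0),
    measurable_const.piecewise hN₁ (measurable_const.piecewise hN₂ measurable_const), ?_, ?_⟩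
  · ext x
    by_cases h₁ : x ∈ N₁ <;> by_cases h₂ : x ∈ N₂ <;>
      simp [h₁, h₂, unitInterval.pos_iff_ne_zero.1 hc₁, unitInterval.pos_iff_ne_zero.1 hc₂]
  · have hsplit : ∀ x, (N₁.piecewise (fun _ => c₁) (N₂.piecewise (fun _ => c₂) 0) x : ℝ) * u x
        = N₁.indicator (fun x => c₁ * u x) x + N₂.indicator (fun x => c₂ * u x) x := fun x => by
      by_cases h₁ : x ∈ N₁
      · simp [h₁, disjoint_left.1 hdisj h₁]
      · by_cases h₂ : x ∈ N₂ <;> simp [h₁, h₂]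
    simp_rw [hsplit]
    rw [integral_add ((hu.const_mul _).indicator hN₁) ((hu.const_mul _).indicator hN₂),
      integral_indicator hN₁, integral_indicator hN₂, integral_const_mul, integral_const_mul]
    exact hbalance

end Weights

instance {α β : Type*} [MeasurableSpace α] [MeasurableSpace β] [MeasurableSingletonClass α]
    [MeasurableSingletonClass β] : MeasurableSingletonClass (α ⊕ β) where
  measurableSet_singleton
    | .inl a => by simpa using (measurableSet_singleton a).inl_image (β := β)
    | .inr b => by simpa using (measurableSet_singleton b).inr_image (α := α)

theorem measure_univ_smul_cond_univ {X : Type*} [MeasurableSpace X] (μ : Measure X)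
    [IsFiniteMeasure μ] : μ univ • μ[|univ] = μ := by
  ext s
  simpa [mul_comm] using cond_mul_eq_inter MeasurableSet.univ s μ

theorem integrable_cond {X E : Type*} [MeasurableSpace X] [NormedAddCommGroup E] {μ : Measure X}
    {s : Set X} {f : X → E} (hf : IntegrableOn f s μ) : Integrable f μ[|s] := by
  by_cases hs : μ s = 0
  · simp [cond_eq_zero_of_meas_eq_zero hs]
  · exact hf.smul_measure (ENNReal.inv_ne_top.2 hs)

theorem ae_ae_posterior_of_ae {X Y : Type*} [MeasurableSpace X] [StandardBorelSpace X] [Nonempty X]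
    [MeasurableSpace Y] {μ : Measure X} [IsFiniteMeasure μ] (κ : Kernel X Y) [IsMarkovKernel κ]
    {q : X → Prop} (hq : ∀ᵐ x ∂μ, q x) : ∀ᵐ y ∂(κ ∘ₘ μ), ∀ᵐ x ∂(posterior κ μ y), q x :=
  Measure.ae_ae_of_ae_comp (by rwa [posterior_comp_self])

section Pooling

variable {X : Type*} [MeasurableSpace X]

/-- The signal that sends the pooling message `Sum.inr ()` with probability `w x` in state `x`, and
reveals the state by the message `Sum.inl x` otherwise. -/
noncomputable def poolingKernel (w : X → I) (hw : Measurable w) : Kernel X (X ⊕ Unit) where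
  toFun x := bernoulliMeasure (Sum.inr ()) (Sum.inl x) (w x)
  measurable' := by
    have hcoe : Measurable fun c : I => (toNNReal c : ℝ≥0∞) :=
      toNNReal_continuous.measurable.coe_nnreal_ennreal
    refine Measure.measurable_of_measurable_coe _ fun s hs => ?_
    simp only [bernoulliMeasure_def, Measure.add_apply, Measure.smul_apply,
      Measure.dirac_apply' _ hs, ENNReal.smul_def, smul_eq_mul]
    exact ((hcoe.comp hw).mul measurable_const).add
      ((hcoe.comp (measurable_symm.comp hw)).mul
        ((measurable_one.indicator hs).comp measurable_inl))

/-- The belief after the pooling message of `poolingKernel w`: the prior `p` reweighted by `w` and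
normalized. It is the zero measure if the pooling message has probability zero. -/
noncomputable def pooledBelief (p : Measure X) (w : X → I) : Measure X :=
  (p.withDensity fun x => (toNNReal (w x) : ℝ≥0∞))[|univ]

/-- The posterior beliefs induced by the prior `p` and the signal `poolingKernel w`. -/
noncomputable def pooledPosterior (p : Measure X) (w : X → I) : Kernel (X ⊕ Unit) X where
  toFun := Sum.elim Measure.dirac fun _ => pooledBelief p w
  measurable' := Measure.measurable_dirac.sumElim measurable_const

variable {p : Measure X} {w : X → I} (hw : Measurable w)

instance : IsMarkovKernel (poolingKernel w hw) :=
  ⟨fun x => inferInstanceAs (IsProbabilityMeasure (bernoulliMeasure _ _ (w x)))⟩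

instance : IsZeroOrProbabilityMeasure (pooledBelief p w) :=
  inferInstanceAs (IsZeroOrProbabilityMeasure (cond _ _))

instance : IsFiniteKernel (pooledPosterior p w) :=
  ⟨1, ENNReal.one_lt_top, by
    rintro (x | _)
    · exact prob_le_one (μ := Measure.dirac x)
    · exact prob_le_one (μ := pooledBelief p w)⟩

@[simp]
theorem pooledPosterior_inl (x : X) : pooledPosterior p w (.inl x) = Measure.dirac x := rfl

@[simp]
theorem pooledPosterior_inr (m : Unit) : pooledPosterior p w (.inr m) = pooledBelief p w := rfl

theorem lintegral_poolingKernel {f : X ⊕ Unit → ℝ≥0∞} (hf : Measurable f) (x : X) :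
    ∫⁻ m, f m ∂poolingKernel w hw x
      = toNNReal (w x) * f (.inr ()) + toNNReal (σ (w x)) * f (.inl x) := by
  change ∫⁻ m, f m ∂bernoulliMeasure _ _ _ = _
  simp only [bernoulliMeasure_def, lintegral_add_measure, lintegral_smul_measure,
    lintegral_dirac' _ hf, ENNReal.smul_def, smul_eq_mul]

theorem integral_poolingKernel [MeasurableSingletonClass X] {E : Type*} [NormedAddCommGroup E]
    [NormedSpace ℝ E] [CompleteSpace E] (f : X ⊕ Unit → E) (x : X) :
    ∫ m, f m ∂poolingKernel w hw x = (w x : ℝ) • f (.inr ()) + (1 - w x : ℝ) • f (.inl x) :=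
  integral_bernoulliMeasure _ _ _ f

theorem withDensity_weight_le : p.withDensity (fun x => (toNNReal (w x) : ℝ≥0∞)) ≤ p := by
  conv_rhs => rw [← withDensity_one (μ := p)]
  exact withDensity_mono (.of_forall fun x => ENNReal.coe_le_one_iff.2 (w x).2.2)

include hw in
theorem integral_pooledBelief (f : X → ℝ) : ∫ x, f x ∂pooledBelief p w
    = (p.withDensity (fun x => (toNNReal (w x) : ℝ≥0∞)) univ)⁻¹.toReal
      * ∫ x, (w x : ℝ) * f x ∂p := by
  rw [pooledBelief, ProbabilityTheory.cond, Measure.restrict_univ, integral_smul_measure,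
    integral_withDensity_eq_integral_smul (f := fun x => toNNReal (w x))
      (toNNReal_continuous.measurable.comp hw)]
  rfl

theorem integrable_pooledBelief {f : X → ℝ} (hf : Integrable f p) :
    Integrable f (pooledBelief p w) :=
  integrable_cond (hf.mono_measure withDensity_weight_le).integrableOn

theorem compProd_pooledPosterior [IsFiniteMeasure p] :
    p.bind (poolingKernel w hw) ⊗ₘ pooledPosterior p w
      = (p ⊗ₘ poolingKernel w hw).map Prod.swap := by
  set ν := p.withDensity fun x => (toNNReal (w x) : ℝ≥0∞)
  have hν : IsFiniteMeasure ν := isFiniteMeasure_of_le p withDensity_weight_le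
  have hw' : Measurable fun x => (toNNReal (w x) : ℝ≥0∞) :=
    (toNNReal_continuous.measurable.comp hw).coe_nnreal_ennreal
  refine Measure.ext_of_lintegral _ fun f hf => ?_
  have hprod : Measurable fun x => toNNReal (w x) * f (.inr (), x) :=
    hw'.mul (hf.comp measurable_prodMk_left)
  have hrevealed (x : X) :
      ∫⁻ y, f (.inl x, y) ∂pooledPosterior p w (.inl x) = f (.inl x, x) :=
    lintegral_dirac' x (hf.comp measurable_prodMk_left)
  have hsignal (x : X) : ∫⁻ m, f (m, x) ∂poolingKernel w hw x
      = toNNReal (w x) * f (.inr (), x) + toNNReal (σ (w x)) * f (.inl x, x) :=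
    lintegral_poolingKernel hw (hf.comp measurable_prodMk_right) x
  have hpooled : ν univ * ∫⁻ y, f (.inr (), y) ∂pooledPosterior p w (.inr ())
      = ∫⁻ x, toNNReal (w x) * f (.inr (), x) ∂p := by
    calc
      _ = ∫⁻ y, f (.inr (), y) ∂(ν univ • ν[|univ]) := (lintegral_smul_measure _ _).symm
      _ = ∫⁻ y, f (.inr (), y) ∂ν := by rw [measure_univ_smul_cond_univ]
      _ = _ := lintegral_withDensity_eq_lintegral_mul _ hw' (hf.comp measurable_prodMk_left)
  rw [Measure.lintegral_compProd hf, Measure.lintegral_bind (Kernel.aemeasurable _)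
    hf.lintegral_kernel_prod_right'.aemeasurable, lintegral_map hf measurable_swap,
    Measure.lintegral_compProd (f := fun q => f q.swap) (hf.comp measurable_swap)]
  simp_rw [lintegral_poolingKernel hw hf.lintegral_kernel_prod_right', Prod.swap_prod_mk,
    hsignal, hrevealed]
  rw [lintegral_add_left (hw'.mul_const _), lintegral_mul_const _ hw',
    lintegral_add_left hprod, ← hpooled,
    withDensity_apply _ MeasurableSet.univ, Measure.restrict_univ]

theorem pooledPosterior_ae_eq_posterior [StandardBorelSpace X] [Nonempty X] [IsFiniteMeasure p] :
    pooledPosterior p w =ᵐ[p.bind (poolingKernel w hw)] posterior (poolingKernel w hw) p :=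
  ae_eq_posterior_of_compProd_eq (compProd_pooledPosterior hw)

end Pooling

/-- The information structure with the signal `poolingKernel w`: each state `ω` is revealed with
probability `1 - w ω` and pooled with the other states otherwise. -/
noncomputable def InfoStructure.pooling (w : ℝ → I) (hw : Measurable w) : InfoStructure where
  Msg := ℝ ⊕ Unit
  kernel := poolingKernel w hw

namespace Environment

variable {E : Environment} {ω a x : ℝ}

theorem isCompact_Ω : IsCompact E.Ω := isCompact_Icc

theorem measurableSet_Ω : MeasurableSet E.Ω := measurableSet_Icc

theorem isCompact_A : IsCompact E.A := isCompact_Icc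

theorem measurableSet_A : MeasurableSet E.A := measurableSet_Icc

theorem ordConnected_A : E.A.OrdConnected := ordConnected_Icc

theorem ae_mem_Ω : ∀ᵐ ω ∂E.prior, ω ∈ E.Ω := E.prior_states

theorem support_prior_subset_Ω : E.prior.support ⊆ E.Ω :=
  Measure.support_subset_of_isClosed isCompact_Ω.isClosed ae_mem_Ω

open scoped Classical in
/-- The optimal action `bliss ω` of a receiver who knows the state `ω`, that is, the zero of
`U_a(ω, ·)`. Outside `Ω` it takes the constant value `actLo`, which keeps it measurable on `ℝ`. -/
noncomputable def bliss (E : Environment) (ω : ℝ) : ℝ :=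
  if ω ∈ E.Ω then Function.invFunOn (E.Ua ω) E.A 0 else E.actLo

/-- The gain of the sender in the state `ω` when the action `bliss ω` is replaced by `x`. -/
noncomputable def gain (E : Environment) (x ω : ℝ) : ℝ := E.V ω x - E.V ω (E.bliss ω)

namespace Regular

variable (hE : E.Regular)
include hE

theorem nonempty_A : E.A.Nonempty :=
  have ⟨ω, hω⟩ := (ae_mem_Ω (E := E)).exists
  have ⟨a, ha, _⟩ := hE.Ua_zero ω hω
  ⟨a, ha⟩

theorem strictAntiOn_Ua (hω : ω ∈ E.Ω) : StrictAntiOn (E.Ua ω) E.A :=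
  (hE.U_concave ω hω).strictAntiOn_derivWithin (hE.U_diff ω hω)

theorem U_le_tangent (hω : ω ∈ E.Ω) (hx : x ∈ E.A) (ha : a ∈ E.A) :
    E.U ω a ≤ E.U ω x + E.Ua ω x * (a - x) :=
  le_add_derivWithin_mul_sub_of_concaveOn (hE.U_concave ω hω).concaveOn hx ha (hE.U_diff ω hω x hx)

theorem integrable_Ua {ν : Measure ℝ} [IsFiniteMeasure ν] (hν : ∀ᵐ ω ∂ν, ω ∈ E.Ω)
    (hx : x ∈ E.A) : Integrable (fun ω => E.Ua ω x) ν :=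
  integrable_of_continuousOn_of_ae_mem isCompact_Ω measurableSet_Ω hν (hE.Ua_cont x hx)

theorem isMaxOn_integral_U {ν : Measure ℝ} [IsFiniteMeasure ν] (hν : ∀ᵐ ω ∂ν, ω ∈ E.Ω)
    (hU : ∀ a ∈ E.A, Integrable (fun ω => E.U ω a) ν) (hx : x ∈ E.A)
    (hfoc : ∫ ω, E.Ua ω x ∂ν = 0) : IsMaxOn (fun a => ∫ ω, E.U ω a ∂ν) E.A x := by
  intro a ha
  have hUa := (hE.integrable_Ua hν hx).mul_const (a - x)
  calc ∫ ω, E.U ω a ∂ν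
      ≤ ∫ ω, (E.U ω x + E.Ua ω x * (a - x)) ∂ν :=
        integral_mono_ae (hU a ha) ((hU x hx).add hUa)
          (hν.mono fun ω hω => hE.U_le_tangent hω hx ha)
    _ = ∫ ω, E.U ω x ∂ν := by
        rw [integral_add (hU x hx) hUa, integral_mul_const, hfoc, zero_mul, add_zero]

theorem bliss_mem (ω : ℝ) : E.bliss ω ∈ E.A := by
  by_cases hω : ω ∈ E.Ω
  · rw [bliss, if_pos hω]
    exact Function.invFunOn_mem (hE.Ua_zero ω hω)
  · rw [bliss, if_neg hω]
    exact left_mem_Icc.2 (nonempty_Icc.1 hE.nonempty_A)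

theorem Ua_bliss (hω : ω ∈ E.Ω) : E.Ua ω (E.bliss ω) = 0 := by
  rw [bliss, if_pos hω]
  exact Function.invFunOn_eq (hE.Ua_zero ω hω)

theorem lt_bliss_iff (hω : ω ∈ E.Ω) (ha : a ∈ E.A) : a < E.bliss ω ↔ 0 < E.Ua ω a := by
  rw [← hE.Ua_bliss hω, (hE.strictAntiOn_Ua hω).lt_iff_gt (hE.bliss_mem ω) ha]

theorem bliss_lt_iff (hω : ω ∈ E.Ω) (ha : a ∈ E.A) : E.bliss ω < a ↔ E.Ua ω a < 0 := by
  rw [← hE.Ua_bliss hω, (hE.strictAntiOn_Ua hω).lt_iff_gt ha (hE.bliss_mem ω)]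

theorem isMaxOn_U_bliss (hω : ω ∈ E.Ω) : IsMaxOn (E.U ω) E.A (E.bliss ω) := fun a ha => by
  simpa [hE.Ua_bliss hω] using hE.U_le_tangent hω (hE.bliss_mem ω) ha

theorem continuousOn_bliss : ContinuousOn E.bliss E.Ω :=
  continuousOn_of_strictAntiOn_of_eq_const ordConnected_A hE.Ua_cont
    (fun _ => hE.strictAntiOn_Ua) (fun ω _ => hE.bliss_mem ω) fun _ => hE.Ua_bliss

open scoped Classical in
theorem measurable_bliss : Measurable E.bliss := by
  have h : ContinuousOn (fun ω => Function.invFunOn (E.Ua ω) E.A 0) E.Ω :=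
    hE.continuousOn_bliss.congr fun ω hω => (if_pos hω).symm
  exact h.measurable_piecewise continuousOn_const measurableSet_Ω

theorem continuousOn_V_sub (ha : a ∈ E.A) :
    ContinuousOn (fun q : ℝ × ℝ => E.V q.1 q.2 - E.V q.1 a) (E.Ω ×ˢ E.A) :=
  have ⟨_, hK⟩ := hE.Va_bdd
  continuousOn_prod_sub_of_continuousOn_derivWithin ordConnected_A hE.V_diff hK hE.Va_cont ha

theorem continuousOn_gain (hx : x ∈ E.A) : ContinuousOn (E.gain x) E.Ω :=
  ((hE.continuousOn_V_sub hx).comp (continuousOn_id.prodMk hE.continuousOn_bliss)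
    fun ω hω => ⟨hω, hE.bliss_mem ω⟩).neg.congr fun _ _ => (neg_sub _ _).symm

theorem integrable_gain (hx : x ∈ E.A) : Integrable (E.gain x) E.prior :=
  integrable_of_continuousOn_of_ae_mem isCompact_Ω measurableSet_Ω ae_mem_Ω
    (hE.continuousOn_gain hx)

theorem integrable_V_compProd {M : Type*} [MeasurableSpace M] (κ : Kernel ℝ M) [IsMarkovKernel κ]
    {α : M → ℝ} (hα : Measurable α) (hαA : ∀ m, α m ∈ E.A) :
    Integrable (fun q : ℝ × M => E.V q.1 (α q.2)) (E.prior ⊗ₘ κ) := by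
  obtain ⟨a, ha⟩ := hE.nonempty_A
  have hfst : MeasurePreserving Prod.fst (E.prior ⊗ₘ κ) E.prior :=
    ⟨measurable_fst, Measure.fst_compProd _ _⟩
  have hmap : Measurable (Prod.map id α : ℝ × M → ℝ × ℝ) := measurable_id.prodMap hα
  have hmem : ∀ᵐ q ∂(E.prior ⊗ₘ κ).map (Prod.map id α), q ∈ E.Ω ×ˢ E.A := by
    refine (ae_map_iff hmap.aemeasurable (measurableSet_Ω.prod measurableSet_A)).2 ?_
    filter_upwards [hfst.quasiMeasurePreserving.ae ae_mem_Ω] with q hq using ⟨hq, hαA q.2⟩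
  have hsub := (integrable_of_continuousOn_of_ae_mem (isCompact_Ω.prod isCompact_A)
    (measurableSet_Ω.prod measurableSet_A) hmem (hE.continuousOn_V_sub ha)).comp_measurable hmap
  exact (hsub.add (hfst.integrable_comp_of_integrable (hE.V_int a ha))).congr
    (.of_forall fun q => sub_add_cancel _ _)

theorem isSenderPayoff_of_isBestResponse {J : InfoStructure} {α : J.Msg → ℝ}
    (hα : E.IsBestResponse J α) :
    E.IsSenderPayoff J (∫ ω, ∫ m, E.V ω (α m) ∂J.kernel ω ∂E.prior) :=
  have hint := hE.integrable_V_compProd J.kernel hα.1 hα.2.1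
  ⟨α, hα, hint, (Measure.integral_compProd hint).symm⟩

theorem isBestResponse_fullDisclosure : E.IsBestResponse fullDisclosure E.bliss := by
  refine ⟨hE.measurable_bliss, hE.bliss_mem, ?_⟩
  change ∀ᵐ m ∂(E.prior.bind (Kernel.id : Kernel ℝ ℝ)), IsMaxOn
    (fun a => ∫ ω, E.U ω a ∂(posterior (Kernel.id : Kernel ℝ ℝ) E.prior m)) E.A (E.bliss m)
  rw [Measure.id_comp]
  filter_upwards [posterior_id E.prior, ae_mem_Ω] with ω hposterior hω
  simpa only [hposterior, Kernel.id_apply, integral_dirac] using! hE.isMaxOn_U_bliss hω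

theorem isSenderPayoff_fullDisclosure :
    E.IsSenderPayoff fullDisclosure (∫ ω, E.V ω (E.bliss ω) ∂E.prior) := by
  convert hE.isSenderPayoff_of_isBestResponse hE.isBestResponse_fullDisclosure with ω
  exact (integral_dirac (fun m => E.V ω (E.bliss m)) ω).symm

section Pooling

variable {w : ℝ → I} (hw : Measurable w) (hx : x ∈ E.A)

include hx

theorem isBestResponse_pooling (hfoc : ∫ ω, (w ω : ℝ) * E.Ua ω x ∂E.prior = 0) :
    E.IsBestResponse (InfoStructure.pooling w hw) (Sum.elim E.bliss fun _ => x) := by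
  refine ⟨hE.measurable_bliss.sumElim measurable_const, Sum.rec hE.bliss_mem fun _ => hx, ?_⟩
  change ∀ᵐ m : ℝ ⊕ Unit ∂E.prior.bind (poolingKernel w hw), IsMaxOn
    (fun a => ∫ ω, E.U ω a ∂posterior (poolingKernel w hw) E.prior m) E.A
    (Sum.elim E.bliss (fun _ => x) m)
  filter_upwards [pooledPosterior_ae_eq_posterior hw,
    ae_ae_posterior_of_ae (poolingKernel w hw) ae_mem_Ω] with m hm hmem
  rw [← hm] at hmem ⊢
  rcases m with ω | m
  · rw [pooledPosterior_inl] at hmem ⊢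
    have hω : ω ∈ E.Ω := (ae_dirac_iff measurableSet_Ω).1 hmem
    simpa only [integral_dirac] using! hE.isMaxOn_U_bliss hω
  · rw [pooledPosterior_inr] at hmem ⊢
    refine hE.isMaxOn_integral_U hmem (fun a ha => integrable_pooledBelief (hE.U_int a ha)) hx ?_
    change ∫ ω, E.Ua ω x ∂_ = 0
    rw [integral_pooledBelief hw, hfoc, mul_zero]

theorem isSenderPayoff_pooling (hfoc : ∫ ω, (w ω : ℝ) * E.Ua ω x ∂E.prior = 0) :
    E.IsSenderPayoff (InfoStructure.pooling w hw)
      (∫ ω, E.V ω (E.bliss ω) ∂E.prior + ∫ ω, (w ω : ℝ) * E.gain x ω ∂E.prior) := by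
  have hint : Integrable (fun ω => E.V ω (E.bliss ω)) E.prior :=
    ((hE.V_int x hx).sub (hE.integrable_gain hx)).congr (.of_forall fun ω => sub_sub_cancel _ _)
  convert hE.isSenderPayoff_of_isBestResponse (hE.isBestResponse_pooling hw hx hfoc)
  rw [← integral_add hint (integrable_weight_mul hw (hE.integrable_gain hx))]
  congr with ω
  refine Eq.trans ?_ (integral_poolingKernel hw _ ω).symm
  simp only [gain, Sum.elim_inl, Sum.elim_inr, smul_eq_mul]
  ring

include hw in
theorem isSuboptimal_fullDisclosure_of_weight
    (hfoc : ∫ ω, (w ω : ℝ) * E.Ua ω x ∂E.prior = 0)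
    (hgain : 0 < ∫ ω, (w ω : ℝ) * E.gain x ω ∂E.prior) :
    E.IsSuboptimal fullDisclosure :=
  ⟨_, hE.isSenderPayoff_fullDisclosure, _, _, hE.isSenderPayoff_pooling hw hx hfoc,
    lt_add_of_pos_right _ hgain⟩

end Pooling

theorem isSuboptimal_fullDisclosure_of_multiplier {ω₁ ω₂ r : ℝ} (hx : x ∈ E.A)
    (hω₁ : ω₁ ∈ E.prior.support) (hω₂ : ω₂ ∈ E.prior.support)
    (hU₁ : E.Ua ω₁ x < 0) (hU₂ : 0 < E.Ua ω₂ x)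
    (hL₁ : 0 < E.gain x ω₁ + r * E.Ua ω₁ x) (hL₂ : 0 < E.gain x ω₂ + r * E.Ua ω₂ x) :
    E.IsSuboptimal fullDisclosure := by
  have hUa := hE.integrable_Ua ae_mem_Ω hx
  have hgain := hE.integrable_gain hx
  have hLcont : ContinuousOn (fun ω => E.gain x ω + r * E.Ua ω x) E.Ω :=
    (hE.continuousOn_gain hx).add ((hE.Ua_cont x hx).const_mul r)
  have hΩ₁ := support_prior_subset_Ω hω₁
  have hΩ₂ := support_prior_subset_Ω hω₂
  obtain ⟨N₁, hN₁, hμ₁, h₁⟩ := exists_measurableSet_pos_forall_of_mem_support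
    measurableSet_Ω ae_mem_Ω hω₁ (((hLcont ω₁ hΩ₁).eventually_const_lt hL₁).and
      ((hE.Ua_cont x hx ω₁ hΩ₁).eventually_lt_const hU₁))
  obtain ⟨N₂, hN₂, hμ₂, h₂⟩ := exists_measurableSet_pos_forall_of_mem_support
    measurableSet_Ω ae_mem_Ω hω₂ (((hLcont ω₂ hΩ₂).eventually_const_lt hL₂).and
      ((hE.Ua_cont x hx ω₂ hΩ₂).eventually_const_lt hU₂))
  obtain ⟨w, hw, hsupport, hfoc⟩ := exists_weight_integral_mul_eq_zero hUa hN₁ hN₂ hμ₁ hμ₂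
    (fun ω hω => (h₁ ω hω).2) fun ω hω => (h₂ ω hω).2
  have hLpos : 0 < ∫ ω, (w ω : ℝ) * (E.gain x ω + r * E.Ua ω x) ∂E.prior := by
    refine integral_weight_mul_pos hw (hgain.add (hUa.const_mul r)) ?_ ?_ <;> rw [hsupport]
    · exact fun ω hω => hω.elim (fun h => (h₁ ω h).1) fun h => (h₂ ω h).1
    · exact hμ₁.trans_le (measure_mono subset_union_left)
  refine hE.isSuboptimal_fullDisclosure_of_weight hw hx hfoc ?_
  calc 0 < ∫ ω, (w ω : ℝ) * (E.gain x ω + r * E.Ua ω x) ∂E.prior := hLpos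
    _ = ∫ ω, ((w ω : ℝ) * E.gain x ω + r * ((w ω : ℝ) * E.Ua ω x)) ∂E.prior := by
        congr with ω
        ring
    _ = ∫ ω, (w ω : ℝ) * E.gain x ω ∂E.prior := by
        rw [integral_add (integrable_weight_mul hw hgain)
          ((integrable_weight_mul hw hUa).const_mul r), integral_const_mul, hfoc, mul_zero,
          add_zero]

theorem exists_V_sub_eq {b : ℝ} (hω : ω ∈ E.Ω) (ha : a ∈ E.A) (hb : b ∈ E.A) (hab : a < b) :
    ∃ c ∈ Ioo a b,
      E.V ω b - E.V ω a = E.Va ω c / (-E.Uaa ω c) * (E.Ua ω a - E.Ua ω b) := by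
  obtain ⟨c, hc, h⟩ := exists_sub_eq_derivWithin_div_mul_sub ordConnected_A (hE.V_diff ω hω)
    (hE.Ua_diff ω hω) ha hb hab fun c hc =>
      (hE.Uaa_neg ω hω c (ordConnected_A.out ha hb (Ioo_subset_Icc_self hc))).ne
  refine ⟨c, hc, h.trans ?_⟩
  change E.Va ω c / E.Uaa ω c * _ = _
  rw [div_neg, neg_mul, ← mul_neg, neg_sub]

theorem exists_multiplier {ω₁ ω₂ : ℝ} (hω₁ : ω₁ ∈ E.Ω) (hω₂ : ω₂ ∈ E.Ω)
    (hnt : E.NonTransparent ω₁ ω₂) (hx : x ∈ E.A) (hU₁ : E.Ua ω₁ x < 0) (hU₂ : 0 < E.Ua ω₂ x) :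
    ∃ r, 0 < E.gain x ω₁ + r * E.Ua ω₁ x ∧ 0 < E.gain x ω₂ + r * E.Ua ω₂ x := by
  have hb₁ := hE.bliss_mem ω₁
  have hb₂ := hE.bliss_mem ω₂
  obtain ⟨a₁, ha₁, hV₁⟩ := hE.exists_V_sub_eq hω₁ hb₁ hx ((hE.bliss_lt_iff hω₁ hx).2 hU₁)
  obtain ⟨a₂, ha₂, hV₂⟩ := hE.exists_V_sub_eq hω₂ hx hb₂ ((hE.lt_bliss_iff hω₂ hx).2 hU₂)
  have hA₁ : a₁ ∈ E.A := ordConnected_A.out hb₁ hx (Ioo_subset_Icc_self ha₁)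
  have hA₂ : a₂ ∈ E.A := ordConnected_A.out hx hb₂ (Ioo_subset_Icc_self ha₂)
  obtain ⟨r, hr₂, hr₁⟩ := exists_between <| hnt a₁ a₂ ⟨hA₁, hA₂, ha₁.2.trans ha₂.1,
    (hE.bliss_lt_iff hω₁ hA₁).1 ha₁.1, (hE.lt_bliss_iff hω₂ hA₂).1 ha₂.2⟩
  rw [hE.Ua_bliss hω₁] at hV₁
  rw [hE.Ua_bliss hω₂] at hV₂
  refine ⟨r, ?_, ?_⟩ <;> rw [gain]
  · linear_combination -hV₁ + mul_pos (sub_pos.2 hr₁) (neg_pos.2 hU₁)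
  · linear_combination mul_pos (sub_pos.2 hr₂) hU₂ + hV₂

end Regular

end Environment

theorem mainTheorem2 (E : Environment) (hE : E.Regular) (ω₁ ω₂ : ℝ)
    (hω₁ : ω₁ ∈ E.prior.support) (hω₂ : ω₂ ∈ E.prior.support)
    (hnt : E.NonTransparent ω₁ ω₂)
    (hnonvac : ∃ a₁ a₂ : ℝ, E.Opposed ω₁ ω₂ a₁ a₂) :
    E.IsSuboptimal fullDisclosure := by
  obtain ⟨x, a, hx, ha, hxa, hU₁, hU₂⟩ := hnonvac
  have hΩ₁ := Environment.support_prior_subset_Ω hω₁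
  have hΩ₂ := Environment.support_prior_subset_Ω hω₂
  have hU₂x : 0 < E.Ua ω₂ x := hU₂.trans (hE.strictAntiOn_Ua hΩ₂ hx ha hxa)
  obtain ⟨r, hL₁, hL₂⟩ := hE.exists_multiplier hΩ₁ hΩ₂ hnt hx hU₁ hU₂x
  exact hE.isSuboptimal_fullDisclosure_of_multiplier hx hω₁ hω₂ hU₁ hU₂x hL₁ hL₂
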